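/- There are $K$ arms. Pulling arm $i$ yields a true reward drawn, independently of the past and of the algorithm's randomness, from a $\sigma$-sub-Gaussian distribution ($\sigma>0$) with mean $\mu_i$, that is, $\mathbb{E}[e^{s(X-\mu_i)}]\le e^{\sigma^2s^2/2}$ for all $s\in\mathbb{R}$. Let $i^*$ be the unique arm of largest mean, $\Delta_i=\mu_{i^*}-\mu_i$, $\Delta_{\min}=\min_{i\ne i^*}\Delta_i$ and $\Delta_{\max}=\max_i\Delta_i$. In rounds $t=1,\dots,T$ the principal pulls an arm $I_t$, whose true reward is $r_t$. If $I_t=i$, arm $i$ adds an amount $\alpha^{(i)}_t\in\mathbb{R}$ to the reward that the principal sees; this amount is a function $S^{(i)}$ of $t$ and of the rounds before $t$ in which arm $i$ was pulled, with their true rewards and manipulations (an adaptive manipulation strategy). If $I_t\ne i$, then $\alpha^{(i)}_t=0$. Arm $i$ has a budget $B_i$, meaning $\sum_{t=1}^T|\alpha^{(i)}_t|\le B_i$, and $B_{i^*}=0$. Let $n_i(t)$ be the number of pulls of arm $i$ in rounds $1,\dots,t$, let $\widehat\mu_i(t)$ be the average true reward of these pulls, and let $\beta^{(i)}_t=\sum_{\tau\le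 t}\alpha^{(i)}_\tau$. The $\varepsilon$-Greedy principal pulls arm $t$ in each round $t\le K$. In a round $t>K$ it pulls, with probability $\varepsilon_t$, an arm drawn uniformly at random, and otherwise an arm maximizing $\widehat\mu_i(t-1)+\beta^{(i)}_{t-1}/n_i(t-1)$ (ties broken in any non-anticipating way), where $$\varepsilon_t=\min\Big\{1,\frac{cK}{t}\Big\},\qquad c=\max\Big\{20,\frac{36\sigma^2}{\Delta_{\min}^2}\Big\}.$$ Let $R(T)=\sum_{t=1}^T(\mu_{i^*}-r_t)$ be the regret. Then there is a constant $C=C(K,c,\Delta_{\max})$, depending only on $K$, $c$ and $\Delta_{\max}$, such that for all such reward distributions, budgets and adaptive manipulation strategies and all $T\ge2$, $$\mathbb{E}[R(T)]\le\sum_{i\ne i^*}\Big[3B_i+C\,\frac{\ln T}{\Delta_i}\Big].$$ -/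

import Mathlib

open MeasureTheory ProbabilityTheory

namespace StrategicBandit

noncomputable section

/-! Rounds are numbered `1, 2, 3, …` and the arms are `0, …, K - 1`. A trajectory consists of the
pulled arms `I : ℕ → Fin K` and the true rewards `r : ℕ → ℝ`, both indexed by rounds. -/

/-- What an arm has observed: the list, in chronological order, of the triples
(round, true reward, manipulation) of the rounds in which it was pulled. -/
abbrev ArmHistory : Type := List (ℕ × ℝ × ℝ)

/-- An adaptive manipulation strategy of one arm: `S t h` is the amount that the arm adds to its
reward if it is pulled in round `t` and its own history through round `t - 1` is `h`. -/
abbrev Strategy : Type := ℕ → ArmHistory → ℝ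

/-- The history of arm `i` through round `t`, when it uses the strategy `S`. -/
def history {K : ℕ} (S : Strategy) (I : ℕ → Fin K) (r : ℕ → ℝ) (i : Fin K) : ℕ → ArmHistory
  | 0 => []
  | t + 1 =>
    if I (t + 1) = i then
      history S I r i t ++ [(t + 1, r (t + 1), S (t + 1) (history S I r i t))]
    else history S I r i t

/-- The manipulation of arm `i` in round `t`; it is `0` if arm `i` is not pulled in round `t`. -/
def manip {K : ℕ} (S : Fin K → Strategy) (I : ℕ → Fin K) (r : ℕ → ℝ) (i : Fin K) (t : ℕ) : ℝ :=
  if I t = i then S i t (history (S i) I r i (t - 1)) else 0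

/-- The number of pulls of arm `i` in the rounds `1, …, t`. -/
def pulls {K : ℕ} (I : ℕ → Fin K) (i : Fin K) (t : ℕ) : ℕ :=
  ((Finset.Icc 1 t).filter (fun τ => I τ = i)).card

/-- The average true reward obtained from arm `i` in the rounds `1, …, t`. -/
def empMean {K : ℕ} (I : ℕ → Fin K) (r : ℕ → ℝ) (i : Fin K) (t : ℕ) : ℝ :=
  (∑ τ ∈ Finset.Icc 1 t, if I τ = i then r τ else 0) / (pulls I i t : ℝ)

/-- The total manipulation of arm `i` in the rounds `1, …, t`. -/
def totalManip {K : ℕ} (S : Fin K → Strategy) (I : ℕ → Fin K) (r : ℕ → ℝ) (i : Fin K) (t : ℕ) :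
    ℝ :=
  ∑ τ ∈ Finset.Icc 1 t, manip S I r i τ

/-- The average manipulated reward of arm `i` after round `t`, which the principal maximizes when
exploiting. -/
def manipulatedMean {K : ℕ} (S : Fin K → Strategy) (I : ℕ → Fin K) (r : ℕ → ℝ) (i : Fin K)
    (t : ℕ) : ℝ :=
  empMean I r i t + totalManip S I r i t / (pulls I i t : ℝ)

/-- The mean of a reward distribution. -/
def mean (ν : Measure ℝ) : ℝ := ∫ x, x ∂ν

/-- `σ`-sub-Gaussian: `E[exp (s (X - E X))] ≤ exp (σ² s² / 2)` for all real `s`. -/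
def IsSubGaussian (ν : Measure ℝ) (σ : NNReal) : Prop :=
  HasSubgaussianMGF (fun x : ℝ => x - mean ν) (σ ^ 2) ν

/-- The gap of arm `i` below arm `istar`. -/
def gap {K : ℕ} (ν : Fin K → Measure ℝ) (istar i : Fin K) : ℝ := mean (ν istar) - mean (ν i)

/-- The smallest gap of a suboptimal arm. -/
def minGap {K : ℕ} (ν : Fin K → Measure ℝ) (istar : Fin K) : ℝ :=
  ⨅ i : {i : Fin K // i ≠ istar}, gap ν istar i

/-- The largest gap. -/
def maxGap {K : ℕ} (ν : Fin K → Measure ℝ) (istar : Fin K) : ℝ := ⨆ i : Fin K, gap ν istar i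

/-- The constant `c = max {20, 36 σ² / Δ_min²}`. -/
def exploreConst {K : ℕ} (ν : Fin K → Measure ℝ) (istar : Fin K) (σ : NNReal) : ℝ :=
  max 20 (36 * (σ : ℝ) ^ 2 / minGap ν istar ^ 2)

/-- The exploration probability `ε_t = min {1, c K / t}`. -/
def exploreProb (K : ℕ) (c : ℝ) (t : ℕ) : ℝ := min 1 (c * K / t)

/-- A play of the rounds `1, …, T` on the probability space `(Ω, P)`: the arms have the reward
distributions `ν` and the manipulation strategies `S`, and the principal runs `ε`-Greedy with
`ε_t = min {1, c K / t}`. Ties among the maximizers may be broken in any way, possibly at random,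
that does not look at the present or the future. -/
structure EpsGreedyPlay {K : ℕ} (ν : Fin K → Measure ℝ) (c : ℝ) (S : Fin K → Strategy) (T : ℕ)
    {Ω : Type*} [mΩ : MeasurableSpace Ω] (P : Measure Ω) where
  /-- `past t` is the information available after round `t`. -/
  past : Filtration ℕ mΩ
  /-- `X t i` is the true reward that arm `i` yields if it is pulled in round `t`. -/
  X : ℕ → Fin K → Ω → ℝ
  /-- The coin that tells whether to explore in round `t`. -/
  coin : ℕ → Ω → Bool
  /-- The arm drawn uniformly for exploration in round `t`. -/
  draw : ℕ → Ω → Fin K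
  /-- The maximizer chosen for exploitation in round `t`. -/
  greedy : ℕ → Ω → Fin K
  /-- The arm pulled in round `t`. -/
  arm : ℕ → Ω → Fin K
  measurable_X : ∀ t, 1 ≤ t → t ≤ T → ∀ i, Measurable[past t] (X t i)
  measurable_coin : ∀ t, 1 ≤ t → t ≤ T → Measurable[past t] (coin t)
  measurable_draw : ∀ t, 1 ≤ t → t ≤ T → Measurable[past t] (draw t)
  measurable_greedy : ∀ t, K < t → t ≤ T → Measurable[past (t - 1)] (greedy t)
  law_X : ∀ t, 1 ≤ t → t ≤ T → ∀ i, P.map (X t i) = ν i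
  law_coin : ∀ t, 1 ≤ t → t ≤ T →
    P {ω | coin t ω = true} = ENNReal.ofReal (exploreProb K c t)
  law_draw : ∀ t, 1 ≤ t → t ≤ T → ∀ i, P {ω | draw t ω = i} = ENNReal.ofReal (1 / K)
  /-- In each round the past, the coin, the draw and the rewards are mutually independent. -/
  indep : ∀ t, 1 ≤ t → t ≤ T →
    iIndep ![past (t - 1), MeasurableSpace.comap (coin t) inferInstance,
      MeasurableSpace.comap (draw t) inferInstance,
      MeasurableSpace.comap (fun ω i => X t i ω) inferInstance] P
  /-- The first `K` rounds pull each arm once, in order. -/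
  arm_init : ∀ t, 1 ≤ t → t ≤ T → t ≤ K → ∀ ω, (arm t ω : ℕ) + 1 = t
  arm_later : ∀ t, K < t → t ≤ T → ∀ ω,
    arm t ω = if coin t ω = true then draw t ω else greedy t ω
  /-- Exploitation picks an arm of maximal average manipulated reward. -/
  greedy_max : ∀ t, K < t → t ≤ T → ∀ ω i,
    manipulatedMean S (fun τ => arm τ ω) (fun τ => X τ (arm τ ω) ω) i (t - 1) ≤
      manipulatedMean S (fun τ => arm τ ω) (fun τ => X τ (arm τ ω) ω) (greedy t ω) (t - 1)

namespace EpsGreedyPlay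

variable {K : ℕ} {ν : Fin K → Measure ℝ} {c : ℝ} {S : Fin K → Strategy} {T : ℕ}
  {Ω : Type*} [MeasurableSpace Ω] {P : Measure Ω}

/-- The true reward obtained in round `t`. -/
def reward (G : EpsGreedyPlay ν c S T P) (t : ℕ) (ω : Ω) : ℝ := G.X t (G.arm t ω) ω

/-- The manipulation of arm `i` in round `t`. -/
def manipulation (G : EpsGreedyPlay ν c S T P) (i : Fin K) (t : ℕ) (ω : Ω) : ℝ :=
  manip S (fun τ => G.arm τ ω) (fun τ => G.reward τ ω) i t

/-- Arm `i` almost surely spends at most `b` on manipulations. -/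
def WithinBudget (G : EpsGreedyPlay ν c S T P) (i : Fin K) (b : ℝ) : Prop :=
  ∀ᵐ ω ∂P, ∑ t ∈ Finset.Icc 1 T, |G.manipulation i t ω| ≤ b

/-- The regret of the rounds `1, …, T`, measured in true rewards against the mean of `istar`. -/
def regret (G : EpsGreedyPlay ν c S T P) (istar : Fin K) (ω : Ω) : ℝ :=
  ∑ t ∈ Finset.Icc 1 T, (mean (ν istar) - G.reward t ω)

end EpsGreedyPlay

end

end StrategicBandit

/-!
The regret is `∑ i, Δ_i E[n_i(T)]`, so it suffices to bound the expected number of pulls of each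
suboptimal arm `i`. Its pulls after the first `K` rounds are of three kinds. Random exploration
contributes at most `∑ c / t`. Pulls made while `n_i ≤ 3 B_i / Δ_i` number at most
`3 B_i / Δ_i + 1`, and this is where `3 B_i` comes from. In any other pull the manipulation shifts
the average of arm `i` by less than `Δ_i / 3`, and so the empirical mean of arm `i` or of the best
arm is off by at least `Δ_i / 3` (`EpsGreedyPlay.one_le_weight_add_weight`).

The last kind is controlled without concentration of the pull counts and without a union bound over
them. For an arm `j` let
`W_t = exp (∑_{τ ≤ t, arm τ = j} (s (X_τ - μ_j) - σ² s²))` (`EpsGreedyPlay.weight`) with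
`|s| = Δ_i / (3 σ²)`; then `W_t ≥ 1` whenever the empirical mean of `j` is off by `Δ_i / 3` in the
direction of `s`. Sub-Gaussianity bounds the conditional mean of a factor of `W_t` by `exp (-a)`,
where `a = σ² s² / 2`, and a pull in a round `t > K` has conditional probability at least
`ε_t / K`, so
`E[W_t] ≤ (1 - (1 - exp (-a)) ε_t / K) E[W_{t-1}]` (`EpsGreedyPlay.integral_weight_succ`,
`EpsGreedyPlay.integral_weight_mul_pulled_ge`). The choice of `c` gives
`c (1 - exp (-a)) ≥ 1`, hence the factor is at most `1 - 1 / t` once `t ≥ c K`, and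
`t E[W_t] ≤ c K + 1` for all `t`
(`EpsGreedyPlay.mul_integral_weight_le`). Summing over `t` gives `O(log T)`.
-/

namespace StrategicBandit

/-! ### Deterministic counting and numerical estimates -/

/-- Product rule for expectations of functions measurable with respect to independent σ-algebras. -/
theorem integral_mul_of_indep {Ω : Type*} {m₁ m₂ mΩ : MeasurableSpace Ω} {P : Measure Ω}
    (h : Indep m₁ m₂ P) {f g : Ω → ℝ}
    (hf : Measurable[m₁] f) (hg : Measurable[m₂] g) (hfi : Integrable f P)
    (hgi : Integrable g P) :
    Integrable (fun ω => f ω * g ω) P ∧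
      ∫ ω, f ω * g ω ∂P = (∫ ω, f ω ∂P) * ∫ ω, g ω ∂P := by
  have hfg : IndepFun f g P :=
    (IndepFun_iff_Indep f g P).2 (indep_of_indep_of_le h hf.comap_le hg.comap_le)
  exact ⟨hfg.integrable_mul hfi hgi,
    hfg.integral_mul_eq_mul_integral hfi.aestronglyMeasurable hgi.aestronglyMeasurable⟩

theorem pulls_eq_sum {K : ℕ} (I : ℕ → Fin K) (i : Fin K) (t : ℕ) :
    (pulls I i t : ℝ) = ∑ τ ∈ Finset.Icc 1 t, if I τ = i then 1 else 0 := by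
  simp [pulls]

theorem pulls_succ {K : ℕ} (I : ℕ → Fin K) (i : Fin K) (t : ℕ) :
    (pulls I i (t + 1) : ℝ) = pulls I i t + if I (t + 1) = i then 1 else 0 := by
  rw [pulls_eq_sum, pulls_eq_sum, Finset.sum_Icc_succ_top (by omega)]

/-- An arm is pulled at most `x + 1` times while it has been pulled at most `x` times before. -/
theorem sum_pull_few_le {K : ℕ} (I : ℕ → Fin K) (i : Fin K) {x : ℝ} (hx : 0 ≤ x) (T : ℕ) :
    ∑ t ∈ Finset.Icc 1 T, (if I t = i ∧ (pulls I i (t - 1) : ℝ) ≤ x then (1 : ℝ) else 0)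
      ≤ x + 1 := by
  -- The bound by the number of pulls makes the induction go through.
  suffices h : ∑ t ∈ Finset.Icc 1 T,
      (if I t = i ∧ (pulls I i (t - 1) : ℝ) ≤ x then (1 : ℝ) else 0) ≤ min (pulls I i T : ℝ) (x + 1)
    from h.trans (min_le_right _ _)
  induction T with
  | zero => simp; linarith
  | succ t ih =>
    rw [Finset.sum_Icc_succ_top (by omega), pulls_succ, Nat.add_sub_cancel]
    have h1 := ih.trans (min_le_left _ _)
    have h2 := ih.trans (min_le_right _ _)
    apply le_min <;> split_ifs <;> first | linarith | (simp_all; try linarith)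

theorem sum_one_div_le_log {T : ℕ} (hT : 1 ≤ T) :
    ∑ t ∈ Finset.Icc 2 T, (1 : ℝ) / t ≤ Real.log T := by
  have h := harmonic_le_one_add_log T
  rw [harmonic_eq_sum_Icc, ← Finset.add_sum_Ioc_eq_sum_Icc hT] at h
  push_cast at h
  have : Finset.Ioc 1 T = Finset.Icc 2 T := rfl
  rw [this] at h
  simp only [one_div]
  linarith

/-- `c (1 - exp (-a)) ≥ 1` as soon as `c ≥ 2 / a` and `c ≥ 20`; the second bound covers large `a`. -/
theorem one_le_mul_one_sub_exp_neg {a c : ℝ} (ha : 0 < a) (hc : 20 ≤ c) (hca : 2 ≤ c * a) :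
    1 ≤ c * (1 - Real.exp (-a)) := by
  have h1 : a + 1 ≤ Real.exp a := Real.add_one_le_exp a
  have h2 : Real.exp (-a) ≤ 1 / (1 + a) := by
    rw [Real.exp_neg, ← one_div]
    exact one_div_le_one_div_of_le (by linarith) (by linarith)
  have h3 : 1 ≤ c * (1 - 1 / (1 + a)) := by
    have : c * (1 - 1 / (1 + a)) = c * a / (1 + a) := by field_simp; ring
    rw [this, le_div_iff₀ (by linarith)]
    nlinarith
  nlinarith

/-! ### Independence within a round -/

namespace EpsGreedyPlay

variable {K : ℕ} {ν : Fin K → Measure ℝ} {c : ℝ} {S : Fin K → Strategy} {T : ℕ}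
  {Ω : Type*} [mΩ : MeasurableSpace Ω] {P : Measure Ω}

/-- What determines the arm pulled in round `t`: the past, the coin and the draw of that round. -/
@[reducible] def choiceInfo (G : EpsGreedyPlay ν c S T P) (t : ℕ) : MeasurableSpace Ω :=
  G.past (t - 1) ⊔ (MeasurableSpace.comap (G.coin t) inferInstance ⊔
    MeasurableSpace.comap (G.draw t) inferInstance)

theorem comap_coin_le (G : EpsGreedyPlay ν c S T P) {t : ℕ} (h1 : 1 ≤ t) (h2 : t ≤ T) :
    MeasurableSpace.comap (G.coin t) inferInstance ≤ G.past t :=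
  (G.measurable_coin t h1 h2).comap_le

theorem comap_draw_le (G : EpsGreedyPlay ν c S T P) {t : ℕ} (h1 : 1 ≤ t) (h2 : t ≤ T) :
    MeasurableSpace.comap (G.draw t) inferInstance ≤ G.past t :=
  (G.measurable_draw t h1 h2).comap_le

theorem comap_X_le (G : EpsGreedyPlay ν c S T P) {t : ℕ} (h1 : 1 ≤ t) (h2 : t ≤ T) :
    MeasurableSpace.comap (fun ω i => G.X t i ω) inferInstance ≤ G.past t :=
  (@measurable_pi_lambda _ _ _ (G.past t) _ _ (G.measurable_X t h1 h2)).comap_le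

theorem choiceInfo_le (G : EpsGreedyPlay ν c S T P) {t : ℕ} (h1 : 1 ≤ t) (h2 : t ≤ T) :
    G.choiceInfo t ≤ G.past t :=
  sup_le (G.past.mono (Nat.sub_le t 1)) (sup_le (G.comap_coin_le h1 h2) (G.comap_draw_le h1 h2))

theorem measurable_arm_choiceInfo (G : EpsGreedyPlay ν c S T P) {t : ℕ} (h1 : 1 ≤ t)
    (h2 : t ≤ T) : Measurable[G.choiceInfo t] (G.arm t) := by
  rcases le_or_gt t K with htK | htK
  · have : G.arm t = fun _ => ⟨t - 1, by omega⟩ := by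
      funext ω
      have := G.arm_init t h1 h2 htK ω
      ext
      simp only
      omega
    rw [this]
    exact measurable_const
  · have h : G.arm t = fun ω => if G.coin t ω = true then G.draw t ω else G.greedy t ω :=
      funext (G.arm_later t htK h2)
    rw [h]
    refine Measurable.ite ?_ ?_ ?_
    · exact (le_sup_left.trans le_sup_right : _ ≤ G.choiceInfo t) _ ⟨{true}, trivial, rfl⟩
    · exact (comap_measurable (G.draw t)).mono (le_sup_right.trans le_sup_right) le_rfl
    · exact (G.measurable_greedy t htK h2).mono le_sup_left le_rfl

theorem measurable_arm (G : EpsGreedyPlay ν c S T P) {t : ℕ} (h1 : 1 ≤ t) (h2 : t ≤ T) :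
    Measurable[G.past t] (G.arm t) :=
  (G.measurable_arm_choiceInfo h1 h2).mono (G.choiceInfo_le h1 h2) le_rfl

theorem sources_le (G : EpsGreedyPlay ν c S T P) {t : ℕ} (h1 : 1 ≤ t) (h2 : t ≤ T) (j : Fin 4) :
    (![G.past (t - 1), MeasurableSpace.comap (G.coin t) inferInstance,
      MeasurableSpace.comap (G.draw t) inferInstance,
      MeasurableSpace.comap (fun ω i => G.X t i ω) inferInstance] :
        Fin 4 → MeasurableSpace Ω) j ≤ mΩ := by
  have hp := G.past.le t
  fin_cases j
  · exact G.past.le _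
  · exact (G.comap_coin_le h1 h2).trans hp
  · exact (G.comap_draw_le h1 h2).trans hp
  · exact (G.comap_X_le h1 h2).trans hp

/-- The rewards of a round are independent of the choice of the arm in that round. -/
theorem indep_choiceInfo_X (G : EpsGreedyPlay ν c S T P) {t : ℕ} (h1 : 1 ≤ t) (h2 : t ≤ T) :
    Indep (G.choiceInfo t) (MeasurableSpace.comap (fun ω i => G.X t i ω) inferInstance) P := by
  have h := indep_iSup_of_disjoint (G.sources_le h1 h2) (G.indep t h1 h2)
    (S := {0, 1, 2}) (T := {3}) (by simp)
  simpa [iSup_or, iSup_sup_eq, choiceInfo] using h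

theorem indep_past_explore (G : EpsGreedyPlay ν c S T P) {t : ℕ} (h1 : 1 ≤ t) (h2 : t ≤ T) :
    Indep (G.past (t - 1)) (MeasurableSpace.comap (G.coin t) inferInstance ⊔
      MeasurableSpace.comap (G.draw t) inferInstance) P := by
  have h := indep_iSup_of_disjoint (G.sources_le h1 h2) (G.indep t h1 h2)
    (S := {0}) (T := {1, 2}) (by simp)
  simpa [iSup_or, iSup_sup_eq, choiceInfo] using h

/-- The event that the principal explores in round `t` and draws arm `i`. -/
def exploreSet (G : EpsGreedyPlay ν c S T P) (i : Fin K) (t : ℕ) : Set Ω :=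
  {ω | G.coin t ω = true} ∩ {ω | G.draw t ω = i}

theorem measurableSet_exploreSet_sup (G : EpsGreedyPlay ν c S T P) (i : Fin K) (t : ℕ) :
    MeasurableSet[MeasurableSpace.comap (G.coin t) inferInstance ⊔
      MeasurableSpace.comap (G.draw t) inferInstance] (G.exploreSet i t) := by
  refine MeasurableSet.inter ?_ ?_
  · exact (le_sup_left : MeasurableSpace.comap (G.coin t) inferInstance ≤ _) _
      ⟨{true}, trivial, rfl⟩
  · exact (le_sup_right : MeasurableSpace.comap (G.draw t) inferInstance ≤ _) _
      ⟨{i}, trivial, rfl⟩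

theorem measurableSet_exploreSet (G : EpsGreedyPlay ν c S T P) (i : Fin K) {t : ℕ} (h1 : 1 ≤ t)
    (h2 : t ≤ T) : MeasurableSet (G.exploreSet i t) :=
  G.past.le t _ (sup_le (G.comap_coin_le h1 h2) (G.comap_draw_le h1 h2) _
    (G.measurableSet_exploreSet_sup i t))

theorem exploreProb_nonneg (hc : 0 ≤ c) (t : ℕ) : 0 ≤ exploreProb K c t :=
  le_min zero_le_one (by positivity)

theorem measureReal_exploreSet (G : EpsGreedyPlay ν c S T P) (hc : 0 ≤ c) (i : Fin K) {t : ℕ}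
    (h1 : 1 ≤ t) (h2 : t ≤ T) : P.real (G.exploreSet i t) = exploreProb K c t / K := by
  have hind : Indep (MeasurableSpace.comap (G.coin t) inferInstance)
      (MeasurableSpace.comap (G.draw t) inferInstance) P :=
    (G.indep t h1 h2).indep (i := 1) (j := 2) (by decide)
  have h := Indep_iff _ _ P |>.1 hind {ω | G.coin t ω = true} {ω | G.draw t ω = i}
    ⟨{true}, trivial, rfl⟩ ⟨{i}, trivial, rfl⟩
  rw [exploreSet, measureReal_def, h, G.law_coin t h1 h2, G.law_draw t h1 h2 i, ENNReal.toReal_mul,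
    ENNReal.toReal_ofReal (exploreProb_nonneg hc t), ENNReal.toReal_ofReal (by positivity)]
  ring

theorem exploreSet_subset (G : EpsGreedyPlay ν c S T P) (i : Fin K) {t : ℕ}
    (hK : K < t) (h2 : t ≤ T) : G.exploreSet i t ⊆ {ω | G.arm t ω = i} := by
  rintro ω ⟨h : G.coin t ω = true, h' : G.draw t ω = i⟩
  change G.arm t ω = i
  rw [G.arm_later t hK h2 ω, if_pos h, h']

theorem measurable_X_comap (G : EpsGreedyPlay ν c S T P) (t : ℕ) (i : Fin K) :
    Measurable[MeasurableSpace.comap (fun ω i => G.X t i ω) inferInstance] (G.X t i) :=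
  (measurable_pi_apply i).comp (comap_measurable (fun ω i => G.X t i ω))

theorem measurable_X' (G : EpsGreedyPlay ν c S T P) {t : ℕ} (h1 : 1 ≤ t) (h2 : t ≤ T)
    (i : Fin K) : Measurable (G.X t i) :=
  (G.measurable_X t h1 h2 i).mono (G.past.le t) le_rfl

theorem integral_comp_X (G : EpsGreedyPlay ν c S T P) {t : ℕ} (h1 : 1 ≤ t) (h2 : t ≤ T)
    (i : Fin K) {f : ℝ → ℝ} (hf : Integrable f (ν i)) :
    Integrable (fun ω => f (G.X t i ω)) P ∧ ∫ ω, f (G.X t i ω) ∂P = ∫ x, f x ∂(ν i) := by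
  have hX := (G.measurable_X' h1 h2 i).aemeasurable (μ := P)
  rw [← G.law_X t h1 h2 i] at hf ⊢
  exact ⟨hf.comp_aemeasurable hX, (integral_map hX hf.aestronglyMeasurable).symm⟩

/-! ### Expected regret and expected pulls -/

/-- The indicator that arm `i` is pulled in round `t`. -/
noncomputable def pulled (G : EpsGreedyPlay ν c S T P) (i : Fin K) (t : ℕ) (ω : Ω) : ℝ :=
  if G.arm t ω = i then 1 else 0

theorem measurable_pulled (G : EpsGreedyPlay ν c S T P) (i : Fin K) {t : ℕ} (h1 : 1 ≤ t)
    (h2 : t ≤ T) : Measurable[G.choiceInfo t] (G.pulled i t) :=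
  (measurable_of_finite fun j : Fin K => if j = i then (1 : ℝ) else 0).comp
    (G.measurable_arm_choiceInfo h1 h2)

theorem pulled_nonneg (G : EpsGreedyPlay ν c S T P) (i : Fin K) (t : ℕ) (ω : Ω) :
    0 ≤ G.pulled i t ω := by
  unfold pulled; split_ifs <;> norm_num

theorem pulled_le_one (G : EpsGreedyPlay ν c S T P) (i : Fin K) (t : ℕ) (ω : Ω) :
    G.pulled i t ω ≤ 1 := by
  unfold pulled; split_ifs <;> norm_num

theorem integrable_mul_pulled (G : EpsGreedyPlay ν c S T P) (i : Fin K) {t : ℕ} (h1 : 1 ≤ t)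
    (h2 : t ≤ T) {f : Ω → ℝ} (hf : Integrable f P) :
    Integrable (fun ω => f ω * G.pulled i t ω) P := by
  refine hf.mul_bdd (c := 1) ?_ (Filter.Eventually.of_forall fun ω => ?_)
  · exact ((G.measurable_pulled i h1 h2).mono ((G.choiceInfo_le h1 h2).trans (G.past.le t))
      le_rfl).aestronglyMeasurable
  · rw [Real.norm_of_nonneg (G.pulled_nonneg i t ω)]
    exact G.pulled_le_one i t ω

theorem integrable_pulled [IsProbabilityMeasure P] (G : EpsGreedyPlay ν c S T P) (i : Fin K)
    {t : ℕ} (h1 : 1 ≤ t) (h2 : t ≤ T) : Integrable (G.pulled i t) P := by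
  simpa using G.integrable_mul_pulled i h1 h2 (integrable_const (μ := P) (1 : ℝ))

theorem reward_eq_sum (G : EpsGreedyPlay ν c S T P) (t : ℕ) (ω : Ω) :
    G.reward t ω = ∑ i, G.pulled i t ω * G.X t i ω := by
  simp [reward, pulled]

/-- The expected reward of a round, by the independence of the pulled arm and the rewards. -/
theorem integral_reward [IsProbabilityMeasure P] (G : EpsGreedyPlay ν c S T P) {t : ℕ}
    (h1 : 1 ≤ t) (h2 : t ≤ T) (hν : ∀ i, Integrable (fun x => x) (ν i)) :
    Integrable (G.reward t) P ∧
      ∫ ω, G.reward t ω ∂P = ∑ i, mean (ν i) * ∫ ω, G.pulled i t ω ∂P := by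
  have key : ∀ i, Integrable (fun ω => G.pulled i t ω * G.X t i ω) P ∧
      ∫ ω, G.pulled i t ω * G.X t i ω ∂P = (∫ ω, G.pulled i t ω ∂P) * mean (ν i) := by
    intro i
    have hX := G.integral_comp_X h1 h2 i (hν i)
    have h := integral_mul_of_indep (G.indep_choiceInfo_X h1 h2)
      (G.measurable_pulled i h1 h2) (G.measurable_X_comap t i) (G.integrable_pulled i h1 h2) hX.1
    exact ⟨h.1, by rw [h.2, hX.2, mean]⟩
  have hr : G.reward t = fun ω => ∑ i, G.pulled i t ω * G.X t i ω :=
    funext (G.reward_eq_sum t)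
  rw [hr]
  refine ⟨integrable_finsetSum _ fun i _ => (key i).1, ?_⟩
  rw [integral_finsetSum _ fun i _ => (key i).1]
  exact Finset.sum_congr rfl fun i _ => by rw [(key i).2, mul_comm]

theorem sum_pulled (G : EpsGreedyPlay ν c S T P) (t : ℕ) (ω : Ω) :
    ∑ i, G.pulled i t ω = 1 := by
  simp [pulled]

/-- Regret decomposition: each pull of arm `i` costs its gap in expectation. -/
theorem integral_regret [IsProbabilityMeasure P] (G : EpsGreedyPlay ν c S T P) (istar : Fin K)
    (hν : ∀ i, Integrable (fun x => x) (ν i)) :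
    Integrable (G.regret istar) P ∧
      ∫ ω, G.regret istar ω ∂P =
        ∑ i, gap ν istar i * ∑ t ∈ Finset.Icc 1 T, ∫ ω, G.pulled i t ω ∂P := by
  have hr : ∀ t ∈ Finset.Icc 1 T, Integrable (fun ω => mean (ν istar) - G.reward t ω) P ∧
      ∫ ω, (mean (ν istar) - G.reward t ω) ∂P =
        ∑ i, gap ν istar i * ∫ ω, G.pulled i t ω ∂P := by
    intro t ht
    obtain ⟨h1, h2⟩ := Finset.mem_Icc.1 ht
    have h := G.integral_reward h1 h2 hν
    refine ⟨(integrable_const _).sub h.1, ?_⟩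
    rw [integral_sub (integrable_const _) h.1, h.2, integral_const]
    have hs : ∑ i, ∫ ω, G.pulled i t ω ∂P = 1 := by
      rw [← integral_finsetSum _ fun i _ => G.integrable_pulled i h1 h2]
      simp [sum_pulled]
    simp only [gap, sub_mul, Finset.sum_sub_distrib, ← Finset.mul_sum, hs]
    simp
  have hreg : G.regret istar = fun ω => ∑ t ∈ Finset.Icc 1 T, (mean (ν istar) - G.reward t ω) := rfl
  rw [hreg]
  refine ⟨integrable_finsetSum _ fun t ht => (hr t ht).1, ?_⟩
  rw [integral_finsetSum _ fun t ht => (hr t ht).1, Finset.sum_congr rfl fun t ht => (hr t ht).2,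
    Finset.sum_comm]
  simp only [Finset.mul_sum]

/-! ### Decay of the exponential weights -/

/-- The exponential weight of the reward deviations of arm `i` through round `t`. The exponent is
centred by `σ² s²` per pull, twice what would make the weight a supermartingale, so that its mean
decays with every pull. It is at least `1` when the empirical mean exceeds the true mean by `σ² s`
(for `s > 0`) or falls short of it by `σ² |s|` (for `s < 0`). -/
noncomputable def weight (G : EpsGreedyPlay ν c S T P) (i : Fin K) (σ s : ℝ) (t : ℕ) (ω : Ω) : ℝ :=
  Real.exp (∑ τ ∈ Finset.Icc 1 t,
    if G.arm τ ω = i then s * (G.X τ i ω - mean (ν i)) - σ ^ 2 * s ^ 2 else 0)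

theorem weight_nonneg (G : EpsGreedyPlay ν c S T P) (i : Fin K) (σ s : ℝ) (t : ℕ) (ω : Ω) :
    0 ≤ G.weight i σ s t ω := Real.exp_nonneg _

theorem weight_zero (G : EpsGreedyPlay ν c S T P) (i : Fin K) (σ s : ℝ) (ω : Ω) :
    G.weight i σ s 0 ω = 1 := by simp [weight]

theorem weight_succ (G : EpsGreedyPlay ν c S T P) (i : Fin K) (σ s : ℝ) (t : ℕ) (ω : Ω) :
    G.weight i σ s (t + 1) ω = (G.weight i σ s t ω - G.weight i σ s t ω * G.pulled i (t + 1) ω) +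
      G.weight i σ s t ω * G.pulled i (t + 1) ω *
        Real.exp (s * (G.X (t + 1) i ω - mean (ν i)) - σ ^ 2 * s ^ 2) := by
  rw [weight, weight, Finset.sum_Icc_succ_top (by omega), Real.exp_add, pulled]
  split_ifs <;> simp

theorem measurable_weight (G : EpsGreedyPlay ν c S T P) (i : Fin K) (σ s : ℝ) {t : ℕ}
    (ht : t ≤ T) : Measurable[G.past t] (G.weight i σ s t) := by
  refine @Measurable.exp _ (G.past t) _ ?_
  refine @Finset.measurable_fun_sum _ _ _ _ _ _ (G.past t) _ _ fun τ hτ => ?_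
  obtain ⟨h1, h2⟩ := Finset.mem_Icc.1 hτ
  refine Measurable.ite ?_ ?_ ?_
  · exact G.past.mono h2 _ (G.measurable_arm h1 (h2.trans ht) (MeasurableSet.singleton i))
  · have hX := (G.measurable_X τ h1 (h2.trans ht) i).mono (G.past.mono h2) le_rfl
    exact (by fun_prop : Measurable fun x : ℝ => s * (x - mean (ν i)) - σ ^ 2 * s ^ 2).comp hX
  · exact measurable_const

/-- A factor of the weight has mean at most `exp (-σ² s² / 2)`. -/
theorem integral_exp_le {μ : Measure ℝ} {σ : NNReal} (h : IsSubGaussian μ σ) (s : ℝ) :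
    Integrable (fun x => Real.exp (s * (x - mean μ) - (σ : ℝ) ^ 2 * s ^ 2)) μ ∧
      ∫ x, Real.exp (s * (x - mean μ) - (σ : ℝ) ^ 2 * s ^ 2) ∂μ ≤
        Real.exp (-((σ : ℝ) ^ 2 * s ^ 2 / 2)) := by
  simp only [sub_eq_add_neg _ ((σ : ℝ) ^ 2 * s ^ 2), Real.exp_add]
  refine ⟨(h.integrable_exp_mul s).mul_const _, ?_⟩
  rw [integral_mul_const]
  have h1 : ∫ x, Real.exp (s * (x - mean μ)) ∂μ ≤ Real.exp ((σ : ℝ) ^ 2 * s ^ 2 / 2) := by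
    simpa [mgf] using h.mgf_le s
  calc _ ≤ Real.exp ((σ : ℝ) ^ 2 * s ^ 2 / 2) * Real.exp (-((σ : ℝ) ^ 2 * s ^ 2)) := by gcongr
    _ = _ := by rw [← Real.exp_add]; ring_nf

/-- The mean weight drops by a fixed fraction of its part on the event that the arm is pulled. -/
theorem integral_weight_succ [IsProbabilityMeasure P] (G : EpsGreedyPlay ν c S T P) (i : Fin K)
    {σ : NNReal} (hσ : IsSubGaussian (ν i) σ) (s : ℝ) {t : ℕ} (ht : t + 1 ≤ T)
    (hint : Integrable (G.weight i σ s t) P) :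
    Integrable (G.weight i σ s (t + 1)) P ∧
      ∫ ω, G.weight i σ s (t + 1) ω ∂P ≤ ∫ ω, G.weight i σ s t ω ∂P -
        (1 - Real.exp (-((σ : ℝ) ^ 2 * s ^ 2 / 2))) *
          ∫ ω, G.weight i σ s t ω * G.pulled i (t + 1) ω ∂P := by
  have h1 : 1 ≤ t + 1 := by omega
  have hexp := integral_exp_le hσ s
  have hX := G.integral_comp_X h1 ht i hexp.1
  have hp := G.integrable_mul_pulled i h1 ht hint
  have hw : Measurable[G.choiceInfo (t + 1)] (G.weight i σ s t) :=
    (G.measurable_weight i σ s (by omega)).mono le_sup_left le_rfl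
  have hm : Measurable[G.choiceInfo (t + 1)] fun ω => G.weight i σ s t ω * G.pulled i (t + 1) ω :=
    hw.mul (G.measurable_pulled i h1 ht)
  have hm' : Measurable[MeasurableSpace.comap (fun ω i => G.X (t + 1) i ω) inferInstance]
      fun ω => Real.exp (s * (G.X (t + 1) i ω - mean (ν i)) - (σ : ℝ) ^ 2 * s ^ 2) :=
    (by fun_prop : Measurable fun x : ℝ =>
      Real.exp (s * (x - mean (ν i)) - (σ : ℝ) ^ 2 * s ^ 2)).comp (G.measurable_X_comap (t + 1) i)
  have h := integral_mul_of_indep (G.indep_choiceInfo_X h1 ht) hm hm' hp hX.1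
  have hsucc : G.weight i σ s (t + 1) = fun ω =>
      (G.weight i σ s t ω - G.weight i σ s t ω * G.pulled i (t + 1) ω) +
      G.weight i σ s t ω * G.pulled i (t + 1) ω *
        Real.exp (s * (G.X (t + 1) i ω - mean (ν i)) - (σ : ℝ) ^ 2 * s ^ 2) :=
    funext (G.weight_succ i σ s t)
  have hd : Integrable
      (fun ω => G.weight i σ s t ω - G.weight i σ s t ω * G.pulled i (t + 1) ω) P := hint.sub hp
  rw [hsucc]
  refine ⟨hd.add h.1, ?_⟩
  rw [integral_add hd h.1, integral_sub hint hp, h.2, hX.2]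
  have h0 : 0 ≤ ∫ ω, G.weight i σ s t ω * G.pulled i (t + 1) ω ∂P :=
    integral_nonneg fun ω => mul_nonneg (Real.exp_nonneg _) (G.pulled_nonneg _ _ _)
  nlinarith [mul_le_mul_of_nonneg_left hexp.2 h0]

theorem integrable_weight [IsProbabilityMeasure P] (G : EpsGreedyPlay ν c S T P) (i : Fin K)
    {σ : NNReal} (hσ : IsSubGaussian (ν i) σ) (s : ℝ) {t : ℕ} (ht : t ≤ T) :
    Integrable (G.weight i σ s t) P := by
  induction t with
  | zero => simp [funext (G.weight_zero i σ s)]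
  | succ t ih => exact (G.integral_weight_succ i hσ s ht (ih (by omega))).1

/-- Exploration is independent of the past and already pulls each arm with probability `ε_t / K`. -/
theorem integral_weight_mul_pulled_ge [IsProbabilityMeasure P] (G : EpsGreedyPlay ν c S T P)
    (hc : 0 ≤ c) (i : Fin K) {σ : NNReal} (hσ : IsSubGaussian (ν i) σ) (s : ℝ) {t : ℕ}
    (hK : K < t + 1) (ht : t + 1 ≤ T) :
    (∫ ω, G.weight i σ s t ω ∂P) * (exploreProb K c (t + 1) / K) ≤
      ∫ ω, G.weight i σ s t ω * G.pulled i (t + 1) ω ∂P := by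
  have h1 : 1 ≤ t + 1 := by omega
  have hint := G.integrable_weight i hσ s (t := t) (by omega)
  have hE := G.measurableSet_exploreSet i h1 ht
  have hg : Measurable[MeasurableSpace.comap (G.coin (t + 1)) inferInstance ⊔
      MeasurableSpace.comap (G.draw (t + 1)) inferInstance]
      ((G.exploreSet i (t + 1)).indicator (1 : Ω → ℝ)) :=
    Measurable.indicator measurable_const (G.measurableSet_exploreSet_sup i (t + 1))
  have h := integral_mul_of_indep (G.indep_past_explore h1 ht) (G.measurable_weight i σ s (by omega))
    (g := (G.exploreSet i (t + 1)).indicator 1) hg hint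
    ((integrable_const (1 : ℝ)).indicator hE)
  rw [Nat.add_sub_cancel] at h
  rw [← G.measureReal_exploreSet hc i h1 ht, ← integral_indicator_one hE, ← h.2]
  refine integral_mono h.1 (G.integrable_mul_pulled i h1 ht hint) fun ω => ?_
  refine mul_le_mul_of_nonneg_left ?_ (Real.exp_nonneg _)
  by_cases hω : ω ∈ G.exploreSet i (t + 1)
  · have : G.arm (t + 1) ω = i := G.exploreSet_subset i hK ht hω
    simp [hω, pulled, this]
  · simpa [hω] using G.pulled_nonneg i (t + 1) ω

/-- The mean weight is `O(1 / t)`: it never exceeds `1`, and once `t ≥ c K`, where `ε_t = c K / t`,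
each round multiplies it by at most `1 - 1 / t`, so that `t E[W_t]` no longer increases. -/
theorem mul_integral_weight_le [IsProbabilityMeasure P] (G : EpsGreedyPlay ν c S T P)
    (hc : 20 ≤ c) (i : Fin K) {σ : NNReal} (hσ : IsSubGaussian (ν i) σ) {s : ℝ}
    (hs : 4 ≤ c * ((σ : ℝ) ^ 2 * s ^ 2)) {t : ℕ} (ht : t ≤ T) :
    t * ∫ ω, G.weight i σ s t ω ∂P ≤ c * K + 1 := by
  have hK : (1 : ℝ) ≤ K := by exact_mod_cast i.pos
  set a := (σ : ℝ) ^ 2 * s ^ 2 / 2 with ha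
  have ha0 : 0 < a := by
    by_contra hneg
    have : (σ : ℝ) ^ 2 * s ^ 2 ≤ 0 := by linarith
    nlinarith
  have hca := one_le_mul_one_sub_exp_neg ha0 hc (by rw [ha]; linarith)
  have hexp : 0 ≤ 1 - Real.exp (-a) := by
    have : Real.exp (-a) ≤ 1 := Real.exp_le_one_iff.2 (by linarith)
    linarith
  have step : ∀ u, u + 1 ≤ T → ∫ ω, G.weight i σ s (u + 1) ω ∂P ≤ ∫ ω, G.weight i σ s u ω ∂P -
        (1 - Real.exp (-a)) * ∫ ω, G.weight i σ s u ω * G.pulled i (u + 1) ω ∂P := fun u hu =>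
    (G.integral_weight_succ i hσ s hu (G.integrable_weight i hσ s (by omega))).2
  have le_one : ∀ u, u ≤ T → ∫ ω, G.weight i σ s u ω ∂P ≤ 1 := by
    intro u hu
    induction u with
    | zero => simp [weight_zero]
    | succ u ih =>
      have h0 : 0 ≤ ∫ ω, G.weight i σ s u ω * G.pulled i (u + 1) ω ∂P :=
        integral_nonneg fun ω => mul_nonneg (Real.exp_nonneg _) (G.pulled_nonneg _ _ _)
      linarith [step u hu, ih (by omega), mul_nonneg hexp h0]
  induction t with
  | zero => simp; positivity
  | succ t ih =>
    rcases le_or_gt ((t + 1 : ℕ) : ℝ) (c * K + 1) with hle | hgt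
    · calc _ ≤ ((t + 1 : ℕ) : ℝ) * 1 := by gcongr; exact le_one _ ht
        _ ≤ _ := by linarith
    · push_cast at hgt ⊢
      have hKt : K < t + 1 := by
        have : (K : ℝ) < t + 1 := by nlinarith
        exact_mod_cast this
      have hprob : exploreProb K c (t + 1) / K = c / (t + 1) := by
        rw [exploreProb, min_eq_right]
        · push_cast; field_simp
        · push_cast
          rw [div_le_one (by positivity)]
          linarith
      have h1 := G.integral_weight_mul_pulled_ge (by linarith) i hσ s hKt ht
      rw [hprob] at h1
      have hw : 0 ≤ ∫ ω, G.weight i σ s t ω ∂P := integral_nonneg fun ω => Real.exp_nonneg _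
      have h2 := step t ht
      have h3 := mul_le_mul_of_nonneg_left h1 hexp
      set w := ∫ ω, G.weight i σ s t ω ∂P
      have h4 : w / (t + 1) ≤ (1 - Real.exp (-a)) * (w * (c / (t + 1))) := by
        have : (1 - Real.exp (-a)) * (w * (c / (t + 1))) =
          w / (t + 1) * (c * (1 - Real.exp (-a))) := by ring
        rw [this]
        exact le_mul_of_one_le_right (by positivity) hca
      calc (t + 1 : ℝ) * ∫ ω, G.weight i σ s (t + 1) ω ∂P
          ≤ (t + 1) * (w - w / (t + 1)) := by gcongr; linarith
        _ = t * w := by field_simp; ring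
        _ ≤ _ := ih (by omega)

/-! ### Pulls caused by manipulation or by a misleading empirical mean -/

theorem pulls_pos (G : EpsGreedyPlay ν c S T P) (i : Fin K) {t : ℕ} (hK : K ≤ t) (ht : t ≤ T)
    (ω : Ω) : 0 < pulls (fun τ => G.arm τ ω) i t := by
  refine Finset.card_pos.2 ⟨i + 1, Finset.mem_filter.2 ⟨Finset.mem_Icc.2 ⟨by omega, by omega⟩, ?_⟩⟩
  have := G.arm_init (i + 1) (by omega) (by omega) (by omega) ω
  exact Fin.ext (by simp only; omega)

/-- The weight is at least `1` if the empirical mean deviates by `σ² |s|` in the direction of `s`. -/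
theorem one_le_weight (G : EpsGreedyPlay ν c S T P) (i : Fin K) {σ s : ℝ} {t : ℕ} (hK : K ≤ t)
    (ht : t ≤ T) (ω : Ω)
    (h : σ ^ 2 * s ^ 2 ≤
      s * (empMean (fun τ => G.arm τ ω) (fun τ => G.reward τ ω) i t - mean (ν i))) :
    1 ≤ G.weight i σ s t ω := by
  have hn : (0 : ℝ) < pulls (fun τ => G.arm τ ω) i t := by exact_mod_cast G.pulls_pos i hK ht ω
  have hsum : (∑ τ ∈ Finset.Icc 1 t,
      if G.arm τ ω = i then s * (G.X τ i ω - mean (ν i)) - σ ^ 2 * s ^ 2 else 0) =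
      pulls (fun τ => G.arm τ ω) i t *
        (s * (empMean (fun τ => G.arm τ ω) (fun τ => G.reward τ ω) i t - mean (ν i)) -
          σ ^ 2 * s ^ 2) := by
    have hE : (pulls (fun τ => G.arm τ ω) i t : ℝ) *
        empMean (fun τ => G.arm τ ω) (fun τ => G.reward τ ω) i t =
        ∑ τ ∈ Finset.Icc 1 t, if G.arm τ ω = i then G.reward τ ω else 0 :=
      mul_div_cancel₀ _ hn.ne'
    calc _ = ∑ τ ∈ Finset.Icc 1 t, (s * (if G.arm τ ω = i then G.reward τ ω else 0) -
          (s * mean (ν i) + σ ^ 2 * s ^ 2) * (if G.arm τ ω = i then 1 else 0)) := by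
          refine Finset.sum_congr rfl fun τ _ => ?_
          split_ifs with h
          · rw [reward, h]; ring
          · ring
      _ = s * (pulls (fun τ => G.arm τ ω) i t *
            empMean (fun τ => G.arm τ ω) (fun τ => G.reward τ ω) i t) -
          (s * mean (ν i) + σ ^ 2 * s ^ 2) * pulls (fun τ => G.arm τ ω) i t := by
          rw [hE, pulls_eq_sum, Finset.sum_sub_distrib, Finset.mul_sum, Finset.mul_sum]
      _ = _ := by ring
  rw [weight, hsum]
  exact Real.one_le_exp (mul_nonneg hn.le (sub_nonneg.2 h))

/-- If a suboptimal arm is pulled greedily after more than `3 b / Δ` pulls, its average manipulation is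
below `Δ / 3`, so one of the two empirical means is off by `Δ / 3` and the matching weight is at
least `1`. -/
theorem one_le_weight_add_weight (G : EpsGreedyPlay ν c S T P) {istar i : Fin K} {σ b : ℝ}
    (hσ : 0 < σ) (hgap : 0 < gap ν istar i) {t : ℕ} (hK : K < t) (ht : t ≤ T) (ω : Ω)
    (harm : G.arm t ω = i) (hexp : ω ∉ G.exploreSet i t)
    (hb : ∑ τ ∈ Finset.Icc 1 T, |G.manipulation i τ ω| ≤ b)
    (hstar : ∑ τ ∈ Finset.Icc 1 T, |G.manipulation istar τ ω| ≤ 0)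
    (hn : 3 * b / gap ν istar i < pulls (fun τ => G.arm τ ω) i (t - 1)) :
    1 ≤ G.weight i σ (gap ν istar i / (3 * σ ^ 2)) (t - 1) ω +
      G.weight istar σ (-(gap ν istar i / (3 * σ ^ 2))) (t - 1) ω := by
  have hgreedy : G.greedy t ω = i := by
    have h := G.arm_later t hK ht ω
    split_ifs at h with hcoin
    · exact absurd ⟨hcoin, h.symm.trans harm⟩ hexp
    · exact h.symm.trans harm
  have hmax := G.greedy_max t hK ht ω istar
  rw [hgreedy] at hmax
  have hsub : Finset.Icc 1 (t - 1) ⊆ Finset.Icc 1 T := Finset.Icc_subset_Icc_right (by omega)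
  have htot : ∀ j, |totalManip S (fun τ => G.arm τ ω) (fun τ => G.reward τ ω) j (t - 1)| ≤
      ∑ τ ∈ Finset.Icc 1 T, |G.manipulation j τ ω| := fun j =>
    (Finset.abs_sum_le_sum_abs _ _).trans
      (Finset.sum_le_sum_of_subset_of_nonneg hsub fun _ _ _ => abs_nonneg _)
  have hn0 : (0 : ℝ) < pulls (fun τ => G.arm τ ω) i (t - 1) := by
    exact_mod_cast G.pulls_pos i (by omega) (by omega) ω
  have htoti : totalManip S (fun τ => G.arm τ ω) (fun τ => G.reward τ ω) i (t - 1) /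
      pulls (fun τ => G.arm τ ω) i (t - 1) < gap ν istar i / 3 := by
    rw [div_lt_iff₀ hn0]
    rw [div_lt_iff₀ hgap] at hn
    linarith [(le_abs_self _).trans ((htot i).trans hb)]
  have htotstar : totalManip S (fun τ => G.arm τ ω) (fun τ => G.reward τ ω) istar (t - 1) = 0 :=
    abs_nonpos_iff.1 ((htot istar).trans hstar)
  change empMean _ (fun τ => G.reward τ ω) _ _ +
    totalManip S _ (fun τ => G.reward τ ω) _ _ / _ ≤ empMean _ (fun τ => G.reward τ ω) _ _ +
    totalManip S _ (fun τ => G.reward τ ω) _ _ / _ at hmax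
  rw [htotstar, zero_div, add_zero] at hmax
  have hs : 0 < gap ν istar i / (3 * σ ^ 2) := by positivity
  -- With this `s`, deviating by `σ² s` means deviating by a third of the gap.
  have hvar : σ ^ 2 * (gap ν istar i / (3 * σ ^ 2)) ^ 2 =
      gap ν istar i / (3 * σ ^ 2) * (gap ν istar i / 3) := by field_simp
  by_cases hi : gap ν istar i / 3 ≤
      empMean (fun τ => G.arm τ ω) (fun τ => G.reward τ ω) i (t - 1) - mean (ν i)
  · have := G.one_le_weight i (σ := σ) (s := gap ν istar i / (3 * σ ^ 2)) (t := t - 1)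
      (by omega) (by omega) ω (by rw [hvar]; gcongr)
    have h0 : 0 ≤ G.weight istar σ (-(gap ν istar i / (3 * σ ^ 2))) (t - 1) ω :=
    G.weight_nonneg _ _ _ _ _
    linarith
  · have hlow : gap ν istar i / 3 ≤
        mean (ν istar) - empMean (fun τ => G.arm τ ω) (fun τ => G.reward τ ω) istar (t - 1) := by
      have : gap ν istar i = mean (ν istar) - mean (ν i) := rfl
      linarith
    have := G.one_le_weight istar (σ := σ) (s := -(gap ν istar i / (3 * σ ^ 2))) (t := t - 1)
      (by omega) (by omega) ω (by
        rw [neg_sq, hvar, neg_mul_comm, neg_sub]; gcongr)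
    have h0 : 0 ≤ G.weight i σ (gap ν istar i / (3 * σ ^ 2)) (t - 1) ω :=
    G.weight_nonneg _ _ _ _ _
    linarith

/-- The pulls of arm `i`: the first `K` rounds, pulls within reach of the budget, exploration, and
greedy pulls paid for by the weights. -/
theorem sum_pulled_le (G : EpsGreedyPlay ν c S T P) {istar i : Fin K} {σ b : ℝ}
    (hσ : 0 < σ) (hgap : 0 < gap ν istar i) (ω : Ω)
    (hb : ∑ τ ∈ Finset.Icc 1 T, |G.manipulation i τ ω| ≤ b)
    (hstar : ∑ τ ∈ Finset.Icc 1 T, |G.manipulation istar τ ω| ≤ 0) :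
    ∑ t ∈ Finset.Icc 1 T, G.pulled i t ω ≤ K + (3 * b / gap ν istar i + 1) +
      ∑ t ∈ Finset.Icc (K + 1) T, ((G.exploreSet i t).indicator 1 ω +
        (G.weight i σ (gap ν istar i / (3 * σ ^ 2)) (t - 1) ω +
          G.weight istar σ (-(gap ν istar i / (3 * σ ^ 2))) (t - 1) ω)) := by
  have hb0 : 0 ≤ b := (Finset.sum_nonneg fun _ _ => abs_nonneg _).trans hb
  have hfew := sum_pull_few_le (fun τ => G.arm τ ω) i
    (x := 3 * b / gap ν istar i) (by positivity) T
  have hinit : ∑ t ∈ Finset.Icc 1 T, (if t ≤ K then (1 : ℝ) else 0) ≤ K := by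
    rw [Finset.sum_boole]
    have : (Finset.Icc 1 T).filter (· ≤ K) ⊆ Finset.Icc 1 K := fun t => by simp; omega
    exact_mod_cast (Finset.card_le_card this).trans (by simp)
  have hlate : ∀ f : ℕ → ℝ, ∑ t ∈ Finset.Icc (K + 1) T, f t =
      ∑ t ∈ Finset.Icc 1 T, if K < t then f t else 0 := by
    intro f
    rw [← Finset.sum_filter]
    congr 1
    ext t
    simp
    omega
  refine le_trans ?_ (add_le_add (add_le_add hinit hfew) le_rfl)
  rw [hlate, ← Finset.sum_add_distrib, ← Finset.sum_add_distrib]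
  refine Finset.sum_le_sum fun t ht => ?_
  obtain ⟨h1, h2⟩ := Finset.mem_Icc.1 ht
  have hw1 : 0 ≤ G.weight i σ (gap ν istar i / (3 * σ ^ 2)) (t - 1) ω :=
    G.weight_nonneg _ _ _ _ _
  have hw2 : 0 ≤ G.weight istar σ (-(gap ν istar i / (3 * σ ^ 2))) (t - 1) ω :=
    G.weight_nonneg _ _ _ _ _
  have hind : 0 ≤ (G.exploreSet i t).indicator (1 : Ω → ℝ) ω :=
    Set.indicator_nonneg (fun _ _ => zero_le_one) _
  have hp := G.pulled_le_one i t ω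
  have hfew0 : (0 : ℝ) ≤ if G.arm t ω = i ∧
      (pulls (fun τ => G.arm τ ω) i (t - 1) : ℝ) ≤ 3 * b / gap ν istar i then 1 else 0 := by
    split_ifs <;> norm_num
  rcases le_or_gt t K with htK | htK
  · rw [if_pos htK, if_neg (not_lt.2 htK)]
    linarith
  rw [if_neg (not_le.2 htK), if_pos htK]
  by_cases harm : G.arm t ω = i
  · by_cases hfewt : (pulls (fun τ => G.arm τ ω) i (t - 1) : ℝ) ≤ 3 * b / gap ν istar i
    · rw [if_pos ⟨harm, hfewt⟩]
      linarith
    · by_cases hexp : ω ∈ G.exploreSet i t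
      · rw [Set.indicator_of_mem hexp, Pi.one_apply]
        linarith
      · linarith [G.one_le_weight_add_weight hσ hgap htK h2 ω harm hexp hb hstar (not_le.1 hfewt)]
  · have : G.pulled i t ω = 0 := if_neg harm
    linarith

theorem sum_integral_pulled_le [IsProbabilityMeasure P] (G : EpsGreedyPlay ν c S T P)
    (hc : 20 ≤ c) {istar i : Fin K} {σ : NNReal} (hσ : 0 < σ) {b : ℝ}
    (hsub : ∀ j, IsSubGaussian (ν j) σ) (hgap : 0 < gap ν istar i)
    (hcgap : 36 * (σ : ℝ) ^ 2 / gap ν istar i ^ 2 ≤ c)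
    (hb : G.WithinBudget i b) (hstar : G.WithinBudget istar 0) (hT : 2 ≤ T) :
    ∑ t ∈ Finset.Icc 1 T, ∫ ω, G.pulled i t ω ∂P ≤
      K + (3 * b / gap ν istar i + 1) +
        (c + 4 * (c * K + 1)) * Real.log T := by
  have hσ' : (0 : ℝ) < σ := by exact_mod_cast hσ
  have hK : 1 ≤ K := i.pos
  set s := gap ν istar i / (3 * (σ : ℝ) ^ 2) with hs
  have hcs : 4 ≤ c * ((σ : ℝ) ^ 2 * s ^ 2) := by
    rw [div_le_iff₀ (by positivity)] at hcgap
    have : c * ((σ : ℝ) ^ 2 * s ^ 2) = c * gap ν istar i ^ 2 / (9 * (σ : ℝ) ^ 2) := by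
      rw [hs]; field_simp; norm_num
    rw [this, le_div_iff₀ (by positivity)]
    linarith
  have hround : ∀ t ∈ Finset.Icc (K + 1) T,
      Integrable (fun ω => (G.exploreSet i t).indicator 1 ω +
        (G.weight i σ s (t - 1) ω + G.weight istar σ (-s) (t - 1) ω)) P ∧
      ∫ ω, ((G.exploreSet i t).indicator 1 ω +
        (G.weight i σ s (t - 1) ω + G.weight istar σ (-s) (t - 1) ω)) ∂P ≤
        (c + 4 * (c * K + 1)) * (1 / t) := by
    intro t ht
    obtain ⟨h1, h2⟩ := Finset.mem_Icc.1 ht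
    have hE := G.measurableSet_exploreSet i (by omega) h2
    have hEi : Integrable ((G.exploreSet i t).indicator (1 : Ω → ℝ)) P :=
      (integrable_const (1 : ℝ)).indicator hE
    have hi := G.integrable_weight i (hsub i) s (t := t - 1) (by omega)
    have hst := G.integrable_weight istar (hsub istar) (-s) (t := t - 1) (by omega)
    have his : Integrable
        (fun ω => G.weight i σ s (t - 1) ω + G.weight istar σ (-s) (t - 1) ω) P := hi.add hst
    refine ⟨hEi.add his, ?_⟩
    have ht0 : (0 : ℝ) < t := by exact_mod_cast (by omega : 0 < t)
    -- The weights are those of round `t - 1`; comparing `1 / (t - 1)` with `2 / t` keeps one sum.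
    have ht2 : (t : ℝ) ≤ 2 * ((t - 1 : ℕ) : ℝ) := by exact_mod_cast (by omega : t ≤ 2 * (t - 1))
    have hdecay : ∀ w : ℝ, 0 ≤ w → ((t - 1 : ℕ) : ℝ) * w ≤ c * K + 1 →
        w ≤ 2 * (c * K + 1) * (1 / t) := by
      intro w hw0 hw
      rw [mul_one_div, le_div_iff₀' ht0]
      linarith [mul_le_mul_of_nonneg_right ht2 hw0]
    have hbi := hdecay _ (integral_nonneg fun ω => G.weight_nonneg _ _ _ _ ω)
      (G.mul_integral_weight_le hc i (hsub i) hcs (t := t - 1) (by omega))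
    have hbs := hdecay _ (integral_nonneg fun ω => G.weight_nonneg _ _ _ _ ω)
      (G.mul_integral_weight_le hc istar (hsub istar) (s := -s) (by rwa [neg_sq])
        (t := t - 1) (by omega))
    have hexp : exploreProb K c t / K ≤ c * (1 / t) := by
      have hK' : (0 : ℝ) < K := by exact_mod_cast hK
      rw [div_le_iff₀ hK']
      refine (min_le_right _ _).trans (le_of_eq ?_)
      ring
    rw [integral_add hEi his, integral_add hi hst, integral_indicator_one hE,
      G.measureReal_exploreSet (by linarith) i (by omega) h2]
    linarith
  have hpint : ∀ t ∈ Finset.Icc 1 T, Integrable (G.pulled i t) P := fun t ht =>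
    G.integrable_pulled i (Finset.mem_Icc.1 ht).1 (Finset.mem_Icc.1 ht).2
  have hsum1 : ∑ t ∈ Finset.Icc (K + 1) T, (1 : ℝ) / t ≤ Real.log T :=
    (Finset.sum_le_sum_of_subset_of_nonneg (Finset.Icc_subset_Icc_left (by omega))
      fun _ _ _ => by positivity).trans (sum_one_div_le_log (by omega))
  calc ∑ t ∈ Finset.Icc 1 T, ∫ ω, G.pulled i t ω ∂P
      = ∫ ω, ∑ t ∈ Finset.Icc 1 T, G.pulled i t ω ∂P := (integral_finsetSum _ hpint).symm
    _ ≤ ∫ ω, (K + (3 * b / gap ν istar i + 1) +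
          ∑ t ∈ Finset.Icc (K + 1) T, ((G.exploreSet i t).indicator 1 ω +
            (G.weight i σ s (t - 1) ω + G.weight istar σ (-s) (t - 1) ω))) ∂P := by
        refine integral_mono_ae (integrable_finsetSum _ hpint) ((integrable_const _).add
          (integrable_finsetSum _ fun t ht => (hround t ht).1)) ?_
        filter_upwards [hb, hstar] with ω h1 h2
        exact G.sum_pulled_le hσ' hgap ω h1 h2
    _ = K + (3 * b / gap ν istar i + 1) +
          ∑ t ∈ Finset.Icc (K + 1) T, ∫ ω, ((G.exploreSet i t).indicator 1 ω +
            (G.weight i σ s (t - 1) ω + G.weight istar σ (-s) (t - 1) ω)) ∂P := by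
        rw [integral_add (integrable_const _)
          (integrable_finsetSum _ fun t ht => (hround t ht).1),
          integral_finsetSum _ fun t ht => (hround t ht).1]
        simp
    _ ≤ K + (3 * b / gap ν istar i + 1) + ∑ t ∈ Finset.Icc (K + 1) T,
          ((c + 4 * (c * K + 1)) * (1 / t)) := by
        gcongr with t ht
        exact (hround t ht).2
    _ ≤ _ := by
        rw [← Finset.mul_sum]
        gcongr

end EpsGreedyPlay

/-- The exploration constant, defined through the smallest gap, is large enough for every gap. -/
theorem exploreConst_ge {K : ℕ} (ν : Fin K → Measure ℝ) (σ : NNReal) {istar i : Fin K}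
    (hlt : ∀ j, j ≠ istar → mean (ν j) < mean (ν istar)) (hi : i ≠ istar) :
    36 * (σ : ℝ) ^ 2 / gap ν istar i ^ 2 ≤ exploreConst ν istar σ := by
  have : Nonempty {j : Fin K // j ≠ istar} := ⟨⟨i, hi⟩⟩
  have hpos : 0 < minGap ν istar := by
    obtain ⟨j, hj⟩ := exists_eq_ciInf_of_finite (f := fun j : {j // j ≠ istar} => gap ν istar j)
    rw [minGap, ← hj]
    exact sub_pos.2 (hlt j j.2)
  have hle : minGap ν istar ≤ gap ν istar i :=
    ciInf_le (Set.finite_range fun j : {j // j ≠ istar} => gap ν istar j).bddBelow ⟨i, hi⟩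
  refine le_trans ?_ (le_max_right _ _)
  gcongr

/-- Terms without `log T` are absorbed by `log T ≥ log 2`, and `Δ ≤ M² / Δ` for `Δ ≤ M`. -/
theorem regret_term_le {K T : ℕ} {c D M b N : ℝ} (hc : 20 ≤ c) (hD : 0 < D) (hDM : D ≤ M)
    (hT : 2 ≤ T)
    (hN : N ≤ K + (3 * b / D + 1) + (c + 4 * (c * K + 1)) * Real.log T) :
    D * N ≤ 3 * b + M ^ 2 * ((K + 1) / Real.log 2 + (c + 4 * (c * K + 1))) *
      (Real.log T / D) := by
  have hlog2 : 0 < Real.log 2 := Real.log_pos (by norm_num)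
  have hlog : Real.log 2 ≤ Real.log T := Real.log_le_log (by norm_num) (by exact_mod_cast hT)
  have hA : (0 : ℝ) ≤ K + 1 := by positivity
  have h1 : (K + 1 : ℝ) ≤
      (K + 1) / Real.log 2 * Real.log T := by
    rw [div_mul_eq_mul_div, le_div_iff₀ hlog2]
    gcongr
  set L := Real.log T
  set A := (K + 1 : ℝ)
  have hQ : 0 ≤ (A / Real.log 2 + (c + 4 * (c * K + 1))) * L := by
    have : 0 ≤ L := hlog2.le.trans hlog
    have := div_nonneg hA hlog2.le
    have : 0 ≤ c * K := by positivity
    positivity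
  calc D * N ≤ D * (3 * b / D + (A / Real.log 2 + (c + 4 * (c * K + 1))) * L) := by
        gcongr; linarith
    _ = 3 * b + D ^ 2 * ((A / Real.log 2 + (c + 4 * (c * K + 1))) * L) / D := by field_simp
    _ ≤ 3 * b + M ^ 2 * ((A / Real.log 2 + (c + 4 * (c * K + 1))) * L) / D := by gcongr
    _ = _ := by ring

end StrategicBandit

theorem theorem5 :
    ∃ C : ℕ → ℝ → ℝ → ℝ,
      ∀ (K : ℕ) (ν : Fin K → Measure ℝ) (σ : NNReal) (istar : Fin K) (B : Fin K → ℝ)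
        (S : Fin K → StrategicBandit.Strategy) (T : ℕ)
        (Ω : Type*) [MeasurableSpace Ω] (P : Measure Ω) [IsProbabilityMeasure P]
        (G : StrategicBandit.EpsGreedyPlay ν
          (StrategicBandit.exploreConst ν istar σ) S T P),
        0 < σ →
        (∀ i, IsProbabilityMeasure (ν i)) →
        (∀ i, StrategicBandit.IsSubGaussian (ν i) σ) →
        (∀ i, i ≠ istar → StrategicBandit.mean (ν i) < StrategicBandit.mean (ν istar)) →
        (∀ i, G.WithinBudget i (B i)) →
        B istar = 0 →
        2 ≤ T →
        Integrable (G.regret istar) P ∧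
          ∫ ω, G.regret istar ω ∂P ≤
            ∑ i ∈ Finset.univ.erase istar,
              (3 * B i +
                C K (StrategicBandit.exploreConst ν istar σ) (StrategicBandit.maxGap ν istar) *
                  (Real.log T / StrategicBandit.gap ν istar i)) := by
  refine ⟨fun K c M =>
    M ^ 2 * ((K + 1) / Real.log 2 + (c + 4 * (c * K + 1))), ?_⟩
  intro K ν σ istar B S T Ω _ P _ G hσ hν hsub hlt hB hBstar hT
  -- The sub-Gaussian bound gives integrability of `x - mean`, hence that of `x`.
  have hint : ∀ i, Integrable (fun x => x) (ν i) := fun i => by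
    refine ((hsub i).integrable.add (integrable_const (StrategicBandit.mean (ν i)))).congr ?_
    exact ae_of_all _ fun x => by simp
  obtain ⟨hregi, hreg⟩ := G.integral_regret istar hint
  refine ⟨hregi, ?_⟩
  have hself : StrategicBandit.gap ν istar istar = 0 := sub_self _
  rw [hreg, ← Finset.add_sum_erase _ _ (Finset.mem_univ istar), hself, zero_mul, zero_add]
  refine Finset.sum_le_sum fun i hi => ?_
  have hne := Finset.ne_of_mem_erase hi
  have hgap : 0 < StrategicBandit.gap ν istar i := sub_pos.2 (hlt i hne)
  have hmax : StrategicBandit.gap ν istar i ≤ StrategicBandit.maxGap ν istar :=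
    le_ciSup (Set.finite_range (StrategicBandit.gap ν istar)).bddAbove i
  have hc : 20 ≤ StrategicBandit.exploreConst ν istar σ := le_max_left _ _
  exact StrategicBandit.regret_term_le hc hgap hmax hT
    (G.sum_integral_pulled_le hc hσ hsub hgap (StrategicBandit.exploreConst_ge ν σ hlt hne)
      (hB i) (hBstar ▸ hB istar) hT)
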